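/- Boolean functions on $n$ variables are maps $f:\{\pm1\}^n\to\{\pm1\}$. A $k$-junta is such a function that depends on at most $k$ of its variables, $\mathcal J_k$ is the class of $k$-juntas, $\mathrm{dist}(f,g)=\Pr_x[f(x)\ne g(x)]$ for uniformly random $x$, and $\mathrm{dist}(f,\mathcal J_k)=\min_{g\in\mathcal J_k}\mathrm{dist}(f,g)$. A (randomized) non-adaptive $q$-query algorithm chooses its $q$ query points independently of $f$ and then computes its output from the answers and its randomness. It is an $(\varepsilon_1,\varepsilon_2)$-tolerant $k$-junta tester if, for every $f$, it accepts with probability at least $2/3$ whenever $\mathrm{dist}(f,\mathcal J_k)\le\varepsilon_1$ and rejects with probability at least $2/3$ whenever $\mathrm{dist}(f,\mathcal J_k)\ge\varepsilon_2$. It is an $\varepsilon$-distance estimator for $k$-juntas if, for every $f$, with probability at least $2/3$ its output is within $\varepsilon$ of $\mathrm{dist}(f,\mathcal J_k)$. **(i)** For every constant $C>0$ there is a constant $c>0$ such that for every integer $k\ge2$ and every $\varepsilon\in(2^{-Ck},k^{-2})$ there exist $\varepsilon_1<\varepsilon_2$ in $[0,1/2)$ with $\varepsilon_2-\varepsilon_1=\varepsilon$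 such that every non-adaptive $(\varepsilon_1,\varepsilon_2)$-tolerant $k$-junta tester for functions $f:\{\pm1\}^{2k}\to\{\pm1\}$ makes at least $$\exp\!\Big(c\sqrt{k\log\tfrac1{k\varepsilon}}\Big)$$ queries. **(ii)** There is an absolute constant $a\in\mathbb N$ such that for every constant $C>0$ there is a constant $c>0$ such that for every integer $k\ge2$, every $n\ge2k$ and every $\varepsilon$ with $2^{-Ck}\le\varepsilon<1/20$, every non-adaptive $\varepsilon$-distance estimator for $k$-juntas for functions $f:\{\pm1\}^n\to\{\pm1\}$ makes at least $$2^{\,c\sqrt{k\log(1/\varepsilon)}\,/\,(\log k\cdot\log\log(1/\varepsilon))^{a}}=2^{\widetilde\Omega(\sqrt{k\log(1/\varepsilon)})}$$ queries. -/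

import Mathlib

open MeasureTheory

noncomputable section

namespace JuntaTesting

/-- The Boolean hypercube on `n` bits. -/
abbrev Cube (n : ℕ) : Type := Fin n → Bool

/-- `f` is a `k`-junta: it depends on at most `k` of its `n` input variables. -/
def IsJunta {n : ℕ} (k : ℕ) (f : Cube n → Bool) : Prop :=
  ∃ S : Finset (Fin n), S.card ≤ k ∧ DependsOn f (S : Set (Fin n))

/-- Normalized Hamming distance: the probability that `f x ≠ g x` for uniformly random `x`. -/
def dist {n : ℕ} (f g : Cube n → Bool) : ℝ :=
  ((Finset.univ.filter fun x : Cube n => f x ≠ g x).card : ℝ) / 2 ^ n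

/-- The distance from `f` to the class of `k`-juntas (a minimum, see `isLeast_distJunta`). -/
def distJunta {n : ℕ} (k : ℕ) (f : Cube n → Bool) : ℝ :=
  sInf {d : ℝ | ∃ g : Cube n → Bool, IsJunta k g ∧ dist f g = d}

theorem isLeast_distJunta {n : ℕ} (k : ℕ) (f : Cube n → Bool) :
    IsLeast {d : ℝ | ∃ g : Cube n → Bool, IsJunta k g ∧ dist f g = d} (distJunta k f) := by
  have hfin : {d : ℝ | ∃ g : Cube n → Bool, IsJunta k g ∧ dist f g = d}.Finite :=
    (Set.finite_range fun g : Cube n → Bool => dist f g).subset (by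
      rintro d ⟨g, -, rfl⟩
      exact ⟨g, rfl⟩)
  have hne : {d : ℝ | ∃ g : Cube n → Bool, IsJunta k g ∧ dist f g = d}.Nonempty :=
    ⟨_, fun _ => true, ⟨∅, by simp, fun _ _ _ => rfl⟩, rfl⟩
  exact ⟨hne.csInf_mem hfin, fun d hd => csInf_le hfin.bddBelow hd⟩

/-- A deterministic non-adaptive `q`-query algorithm with outputs in `Out`, for functions on `n`
bits: the list of the `q` query points, fixed in advance, and a map from the `q` answers to the
output. A randomized non-adaptive algorithm is a probability measure on this type (with its
product σ-algebra). -/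
abbrev DetAlg (n q : ℕ) (Out : Type) : Type :=
  (Fin q → Cube n) × ((Fin q → Bool) → Out)

/-- The output of a deterministic non-adaptive algorithm on input `f`. -/
def DetAlg.run {n q : ℕ} {Out : Type} (A : DetAlg n q Out) (f : Cube n → Bool) : Out :=
  A.2 fun i => f (A.1 i)

/-- The randomized non-adaptive `q`-query algorithm `P` is an `(ε₁, ε₂)`-tolerant tester of
`k`-juntas: with probability at least `2/3` it accepts (outputs `true`) every function that is
`ε₁`-close to some `k`-junta, and with probability at least `2/3` it rejects (outputs `false`)
every function that is `ε₂`-far from every `k`-junta. -/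
def IsTolerantTester {n q : ℕ} (k : ℕ) (ε₁ ε₂ : ℝ) (P : Measure (DetAlg n q Bool)) : Prop :=
  ∀ f : Cube n → Bool,
    (distJunta k f ≤ ε₁ → 2 / 3 ≤ P.real {A | A.run f = true}) ∧
    (ε₂ ≤ distJunta k f → 2 / 3 ≤ P.real {A | A.run f = false})

/-- The randomized non-adaptive `q`-query algorithm `P` is an `ε`-distance estimator for
`k`-juntas: for every `f`, with probability at least `2/3` its output is within `ε` of the
distance from `f` to the class of `k`-juntas. -/
def IsDistanceEstimator {n q : ℕ} (k : ℕ) (ε : ℝ) (P : Measure (DetAlg n q ℝ)) : Prop :=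
  ∀ f : Cube n → Bool, 2 / 3 ≤ P.real {A | |A.run f - distJunta k f| ≤ ε}

end JuntaTesting

end

/-! Split `2k` coordinates into `k` pairs. A random selector `s` makes one member of each pair a
control bit and the other an action bit. Fix a set `L` of action vectors of which every member is at
Hamming distance at least `d` from every complement of a member, and let `τ = 2|L|/2^k` be the
density of the two tails. The hard function is `R(ctrl)` on `L` for a random `R`, `σ xor R(ctrl)` on
the complements of `L`, and a parity of the control bits and one action bit in between.

If `σ = false`, the junta `R(ctrl)` errs on half of the middle only, so the distance is at most `(1
- τ)/2`. If `σ = true`, complementing the action bits negates the function, so juntas on the control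
bits are at distance at least `1/2`. Any other `k`-junta ignores some control bit, whose flip
changes the parity on the whole middle and, for most `R`, the value on a quarter of the tails. Hence
the distance is at least `(1 - 3τ/4)/2`, and the gap is `τ/8`.

To tell the cases apart, two queries must share their control bits and lie in opposite tails;
otherwise negating `R` on the cells queried in the upper tail carries one case to the other
(`exists_perm_hardFun`). Such queries differ in at least `d` action bits, and `s` must put all of
these on the action side, which has probability at most `2^(-d)`. A union bound over pairs gives
`2^d ≤ 6q²` (`Decides.two_pow_le`).

It remains to choose `L` of density about `ε` with `d` large. A single low-weight tail is replaced
by a product over `M ≈ log(1/ε)` blocks of length about `k/M`, asking in each for a weight about one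
standard deviation below the mean. This gives `d ≈ M √(k/M) = √(k log(1/ε))`. -/

namespace JuntaTesting

/-! ### Counting with involutions -/

section Involutions

variable {α : Type*} [Fintype α] [DecidableEq α]

/-- A function invariant under an involution `σ` disagrees with `f` on at least half of the points
at which `f` is not invariant. -/
theorem card_ne_comp_le (f g : α → Bool) {σ : α → α} (hσ : Function.Involutive σ)
    (hg : ∀ x, g (σ x) = g x) :
    (Finset.univ.filter fun x => f (σ x) ≠ f x).card ≤
      2 * (Finset.univ.filter fun x => f x ≠ g x).card := by
  -- As `g` agrees at `x` and `σ x` while `f` does not, `g` errs at one of the two.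
  have hsub : (Finset.univ.filter fun x => f (σ x) ≠ f x) ⊆
      (Finset.univ.filter fun x => f x ≠ g x) ∪
        (Finset.univ.filter fun x => f x ≠ g x).image σ := by
    intro x hx
    simp only [Finset.mem_filter, Finset.mem_univ, true_and, Finset.mem_union,
      Finset.mem_image] at hx ⊢
    by_cases h : f x = g x
    · refine Or.inr ⟨σ x, ?_, hσ x⟩
      rw [hg, ← h]
      exact hx
    · exact Or.inl h
  refine (Finset.card_le_card hsub).trans ((Finset.card_union_le _ _).trans ?_)
  have := Finset.card_image_le (s := Finset.univ.filter fun x => f x ≠ g x) (f := σ)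
  omega

/-- If an involution maps `{x | p x}` to its complement within `{x | r x}`, then `p` holds on
at most half of that set. -/
theorem two_mul_card_filter_le (p r : α → Prop) [DecidablePred p] [DecidablePred r] {σ : α → α}
    (hσ : Function.Involutive σ) (hpr : ∀ x, p x → r x) (hr : ∀ x, p x → r (σ x))
    (hp : ∀ x, p x → ¬ p (σ x)) :
    2 * (Finset.univ.filter p).card ≤ (Finset.univ.filter r).card := by
  have hd : Disjoint (Finset.univ.filter p) ((Finset.univ.filter p).image σ) := by
    rw [Finset.disjoint_left]
    intro x hx hx'
    simp only [Finset.mem_filter, Finset.mem_univ, true_and, Finset.mem_image] at hx hx'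
    obtain ⟨y, hy, rfl⟩ := hx'
    exact hp y hy hx
  have hsub : (Finset.univ.filter p) ∪ ((Finset.univ.filter p).image σ) ⊆
      Finset.univ.filter r := by
    intro x hx
    simp only [Finset.mem_filter, Finset.mem_univ, true_and, Finset.mem_union,
      Finset.mem_image] at hx ⊢
    rcases hx with hx | ⟨y, hy, rfl⟩
    · exact hpr x hx
    · exact hr y hy
  have := Finset.card_le_card hsub
  rw [Finset.card_union_of_disjoint hd, Finset.card_image_of_injective _ hσ.injective] at this
  omega

end Involutions

/-! ### Distance to juntas -/

section Distance

variable {n k : ℕ}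

theorem distJunta_le_dist {f g : Cube n → Bool} (hg : IsJunta k g) :
    distJunta k f ≤ dist f g :=
  (isLeast_distJunta k f).2 ⟨g, hg, rfl⟩

theorem le_distJunta {f : Cube n → Bool} {r : ℝ}
    (h : ∀ (S : Finset (Fin n)) (g : Cube n → Bool), S.card ≤ k →
      DependsOn g (S : Set (Fin n)) → r ≤ dist f g) : r ≤ distJunta k f := by
  obtain ⟨g, ⟨S, hS, hg⟩, hd⟩ := (isLeast_distJunta k f).1
  exact (h S g hS hg).trans hd.le

theorem card_filter_div_le_dist (f g : Cube n → Bool) {σ : Cube n → Cube n}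
    (hσ : Function.Involutive σ) (hg : ∀ x, g (σ x) = g x) :
    ((Finset.univ.filter fun x => f (σ x) ≠ f x).card : ℝ) / 2 ^ n / 2 ≤ dist f g := by
  have h : ((Finset.univ.filter fun x => f (σ x) ≠ f x).card : ℝ) ≤
      2 * (Finset.univ.filter fun x => f x ≠ g x).card := mod_cast card_ne_comp_le f g hσ hg
  rw [dist, div_div, mul_comm, ← div_div]
  gcongr
  linarith

theorem distJunta_const (b : Bool) : distJunta k (fun _ : Cube n => b) ≤ 0 := by
  refine (distJunta_le_dist (g := fun _ => b) ⟨∅, by simp, fun _ _ _ => rfl⟩).trans ?_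
  simp [dist]

end Distance

/-! ### Coordinate flips and parity -/

section Flips

variable {ι : Type*}

/-- The bitwise complement. -/
def bitCompl (x : ι → Bool) : ι → Bool := fun i => !x i

@[simp] theorem bitCompl_bitCompl (x : ι → Bool) : bitCompl (bitCompl x) = x := by
  ext i
  simp [bitCompl]

variable [DecidableEq ι]

/-- Negate the coordinates in `D`. -/
def flipOn (D : Finset ι) (x : ι → Bool) : ι → Bool := fun i => if i ∈ D then !x i else x i

theorem flipOn_involutive (D : Finset ι) : Function.Involutive (flipOn D) := by
  intro x
  ext i
  by_cases h : i ∈ D <;> simp [flipOn, h]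

theorem DependsOn.comp_flipOn {g : (ι → Bool) → Bool} {S : Set ι} (hg : DependsOn g S)
    {D : Finset ι} (hD : ∀ i ∈ D, i ∉ S) (x : ι → Bool) : g (flipOn D x) = g x := by
  refine hg fun i hi => ?_
  have : i ∉ D := fun h => hD i h hi
  simp [flipOn, this]

variable [Fintype ι]

/-- The parity of the number of ones. -/
def parity (x : ι → Bool) : Bool := decide ((∑ i, if x i then 1 else 0 : ZMod 2) = 1)

theorem parity_flipOn_singleton (x : ι → Bool) (i : ι) :
    parity (flipOn {i} x) = !parity x := by
  have h : (∑ j, if flipOn {i} x j then 1 else 0 : ZMod 2) =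
      (∑ j, if x j then 1 else 0 : ZMod 2) + 1 := by
    rw [← Finset.add_sum_erase _ _ (Finset.mem_univ i),
      ← Finset.add_sum_erase _ (fun j => if x j = true then (1 : ZMod 2) else 0)
        (Finset.mem_univ i)]
    have : ∑ j ∈ Finset.univ.erase i, (if flipOn {i} x j = true then (1 : ZMod 2) else 0) =
        ∑ j ∈ Finset.univ.erase i, (if x j = true then (1 : ZMod 2) else 0) := by
      refine Finset.sum_congr rfl fun j hj => ?_
      simp [flipOn, Finset.ne_of_mem_erase hj]
    rw [this]
    have h2 : (1 : ZMod 2) + 1 = 0 := by decide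
    cases hx : x i <;> simp [flipOn, hx, add_comm]
    rw [← add_assoc, h2, zero_add]
  unfold parity
  rw [h]
  generalize (∑ j, if x j then 1 else 0 : ZMod 2) = a
  revert a
  decide

end Flips

/-- Some coordinate is ignored by the junta, and flipping it changes the parity everywhere. -/
theorem distJunta_parity {n k : ℕ} (hk : k < n) (b : Bool) :
    1 / 2 ≤ distJunta k (fun x : Cube n => xor b (parity x)) := by
  refine le_distJunta fun S g hS hg => ?_
  obtain ⟨i, hi⟩ : ∃ i, i ∉ S := by
    by_contra! h
    have : S = Finset.univ := Finset.eq_univ_iff_forall.2 h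
    rw [this, Finset.card_univ, Fintype.card_fin] at hS
    omega
  have := card_filter_div_le_dist (fun x : Cube n => xor b (parity x)) g
    (flipOn_involutive {i}) (DependsOn.comp_flipOn hg (by simpa using hi))
  refine le_trans ?_ this
  simp [parity_flipOn_singleton]

/-! ### Uniformity of restricted points -/

section Fibres

variable {n : ℕ} {ι : Type*} [Fintype ι] [DecidableEq ι]

/-- Restricting a uniform point of the cube to distinct coordinates gives a uniform point. -/
theorem card_filter_comp_mem {φ : ι → Fin n} (hφ : Function.Injective φ)
    (T : Finset (ι → Bool)) :
    (Finset.univ.filter fun x : Cube n => x ∘ φ ∈ T).card * 2 ^ Fintype.card ι =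
      T.card * 2 ^ n := by
  set N := (Finset.univ.filter fun x : Cube n => x ∘ φ = fun _ => false).card with hN
  have hfib : ∀ t : ι → Bool, (Finset.univ.filter fun x : Cube n => x ∘ φ = t).card = N := by
    intro t
    -- Translation by the extension of `t` by zero exchanges the fibre over `t` with the fibre over
    -- zero.
    have hinv : Function.Involutive fun (x : Cube n) j =>
        xor (x j) (Function.extend φ t (fun _ => false) j) := by
      intro x
      ext j
      simp
    refine Finset.card_equiv hinv.toPerm fun x => ?_
    simp only [Finset.mem_filter, Finset.mem_univ, true_and, Function.Involutive.coe_toPerm,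
      funext_iff, Function.comp_apply, hφ.extend_apply]
    refine forall_congr' fun i => ?_
    cases x (φ i) <;> cases t i <;> simp
  have hsum : ∀ U : Finset (ι → Bool),
      (Finset.univ.filter fun x : Cube n => x ∘ φ ∈ U).card = U.card * N := by
    intro U
    rw [Finset.card_eq_sum_card_fiberwise (f := fun x : Cube n => x ∘ φ) (t := U)
      (by intro x; simp)]
    rw [Finset.sum_const_nat]
    intro t ht
    rw [← hfib t, Finset.filter_filter]
    congr 1
    ext x
    simp only [Finset.mem_filter, Finset.mem_univ, true_and, and_iff_right_iff_imp]
    rintro rfl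
    exact ht
  have huniv := hsum Finset.univ
  simp only [Finset.mem_univ, Finset.filter_true, Finset.card_univ, Fintype.card_fun,
    Fintype.card_bool, Fintype.card_fin] at huniv
  rw [hsum T, huniv]
  ring

end Fibres

/-! ### The hard functions and their distances -/

section HardFunctions

variable {n k : ℕ} (e : Fin k × Bool ↪ Fin n) (s : Cube k)

/-- The control bits of `x`: the selector `s` chooses one coordinate out of each of `k` pairs. -/
def ctrl (x : Cube n) : Cube k := fun i => x (e (i, s i))

/-- The action bits of `x`: the coordinates of the pairs that are not chosen by `s`. -/
def act (x : Cube n) : Cube k := fun i => x (e (i, !s i))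

/-- The vectors that lie in `L` or whose complements do. -/
def tails (L : Finset (Cube k)) : Finset (Cube k) :=
  Finset.univ.filter fun v => v ∈ L ∨ bitCompl v ∈ L

/-- The hard functions. On the tails of the action bits, the value is a function `R` of the control
bits, the negation of which is taken on the upper tail if `σ` is set; in between, it is a parity. -/
def hardFun (a : Fin k) (L : Finset (Cube k)) (σ : Bool) (R : Cube k → Bool) (x : Cube n) : Bool :=
  if act e s x ∈ L then R (ctrl e s x)
  else if bitCompl (act e s x) ∈ L then xor σ (R (ctrl e s x))
  else xor (parity (ctrl e s x)) (act e s x a)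

/-- The coordinates of the action bits. -/
def actCoords : Finset (Fin n) := Finset.univ.image fun i => e (i, !s i)

/-- The coordinates of the control bits. -/
def ctrlCoords : Finset (Fin n) := Finset.univ.image fun i => e (i, s i)

theorem ctrl_flipOn_actCoords (x : Cube n) :
    ctrl e s (flipOn (actCoords e s) x) = ctrl e s x := by
  ext i
  have : e (i, s i) ∉ actCoords e s := by
    simp only [actCoords, Finset.mem_image, Finset.mem_univ, true_and, not_exists]
    intro j hj
    have := e.injective hj
    simp only [Prod.mk.injEq] at this
    obtain ⟨rfl, h⟩ := this
    simp at h
  simp [ctrl, flipOn, this]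

theorem act_flipOn_actCoords (x : Cube n) :
    act e s (flipOn (actCoords e s) x) = bitCompl (act e s x) := by
  ext i
  have : e (i, !s i) ∈ actCoords e s := Finset.mem_image_of_mem _ (Finset.mem_univ i)
  simp [act, flipOn, bitCompl, this]

theorem ctrl_flipOn_singleton (i : Fin k) (x : Cube n) :
    ctrl e s (flipOn {e (i, s i)} x) = flipOn {i} (ctrl e s x) := by
  ext j
  by_cases h : j = i
  · subst h
    simp [ctrl, flipOn]
  · simp [ctrl, flipOn, h]

theorem act_flipOn_singleton (i : Fin k) (x : Cube n) :
    act e s (flipOn {e (i, s i)} x) = act e s x := by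
  ext j
  simp only [act, flipOn, Finset.mem_singleton, EmbeddingLike.apply_eq_iff_eq, Prod.mk.injEq,
    ite_eq_right_iff, and_imp]
  rintro rfl h
  simp at h

theorem card_tails {L : Finset (Cube k)} (hL : ∀ v ∈ L, bitCompl v ∉ L) :
    (tails L).card = 2 * L.card := by
  have h : tails L = L ∪ L.image bitCompl := by
    ext v
    simp only [tails, Finset.mem_filter, Finset.mem_univ, true_and, Finset.mem_union,
      Finset.mem_image]
    refine or_congr_right ⟨fun h => ⟨_, h, bitCompl_bitCompl v⟩, ?_⟩
    rintro ⟨w, hw, rfl⟩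
    simpa using hw
  have hd : Disjoint L (L.image bitCompl) := by
    rw [Finset.disjoint_left]
    intro v hv hv'
    obtain ⟨w, hw, rfl⟩ := Finset.mem_image.1 hv'
    exact hL w hw hv
  have hinj : Function.Injective (bitCompl : Cube k → Cube k) :=
    Function.Involutive.injective bitCompl_bitCompl
  rw [h, Finset.card_union_of_disjoint hd, Finset.card_image_of_injective _ hinj]
  ring

theorem act_coord_injective : Function.Injective fun i => e (i, !s i) := by
  intro i j h
  have := e.injective h
  simp only [Prod.mk.injEq] at this
  exact this.1

theorem ctrl_coord_injective : Function.Injective fun i => e (i, s i) := by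
  intro i j h
  have := e.injective h
  simp only [Prod.mk.injEq] at this
  exact this.1

theorem card_act_mem (T : Finset (Cube k)) :
    (Finset.univ.filter fun x : Cube n => act e s x ∈ T).card * 2 ^ k = T.card * 2 ^ n := by
  have h := card_filter_comp_mem (act_coord_injective e s) T
  rw [Fintype.card_fin] at h
  exact h

/-- Control and action coordinates are disjoint, so the two vectors are independent and uniform. -/
theorem card_ctrl_mem_act_mem (U T : Finset (Cube k)) :
    (Finset.univ.filter fun x : Cube n => ctrl e s x ∈ U ∧ act e s x ∈ T).card * (2 ^ k * 2 ^ k) =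
      U.card * T.card * 2 ^ n := by
  have hφ : Function.Injective
      (Sum.elim (fun i => e (i, s i)) fun i => e (i, !s i) : Fin k ⊕ Fin k → Fin n) := by
    refine (ctrl_coord_injective e s).sumElim (act_coord_injective e s) fun i j h => ?_
    have := e.injective h
    simp only [Prod.mk.injEq] at this
    obtain ⟨rfl, h⟩ := this
    simp at h
  have h := card_filter_comp_mem hφ
    ((U ×ˢ T).map (Equiv.sumArrowEquivProdArrow (Fin k) (Fin k) Bool).symm.toEmbedding)
  rw [Finset.card_map, Finset.card_product, Fintype.card_sum, Fintype.card_fin, pow_add] at h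
  rw [← h]
  congr 2
  ext x
  simp only [Finset.mem_filter, Finset.mem_univ, true_and, Finset.mem_map_equiv, Equiv.symm_symm,
    Finset.mem_product]
  rfl

variable {e s} {a : Fin k} {L : Finset (Cube k)} {R : Cube k → Bool}

/-- The junta `R(ctrl)` is exact on the tails. In the middle, complementing all action bits
preserves the control bits and negates the function, so at most one point of each such pair is an
error. -/
theorem distJunta_hardFun_false_le (hL : ∀ v ∈ L, bitCompl v ∉ L) :
    distJunta k (hardFun e s a L false R) ≤ (1 - 2 * L.card / 2 ^ k) / 2 := by
  have hj : IsJunta k fun x : Cube n => R (ctrl e s x) := by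
    refine ⟨ctrlCoords e s, Finset.card_image_le.trans (by simp), fun x y hxy => ?_⟩
    have : ctrl e s x = ctrl e s y := by
      ext i
      exact hxy _ (Finset.mem_image_of_mem _ (Finset.mem_univ i))
    simp only [this]
  refine (distJunta_le_dist hj).trans ?_
  have h1 := two_mul_card_filter_le
    (fun x : Cube n => hardFun e s a L false R x ≠ R (ctrl e s x))
    (fun x => act e s x ∈ (tails L)ᶜ) (flipOn_involutive (actCoords e s)) (by
      intro x hx
      simp only [tails, Finset.mem_compl, Finset.mem_filter, Finset.mem_univ, true_and]
      rintro (h | h) <;> simp [hardFun, h] at hx) (by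
      intro x hx
      simp only [tails, Finset.mem_compl, Finset.mem_filter, Finset.mem_univ, true_and,
        act_flipOn_actCoords, bitCompl_bitCompl]
      rintro (h | h) <;> simp [hardFun, h] at hx) (by
      intro x hx
      have h1 : act e s x ∉ L := fun h => by simp [hardFun, h] at hx
      have h2 : bitCompl (act e s x) ∉ L := fun h => by simp [hardFun, h] at hx
      simp only [hardFun, h1, h2, if_false, ctrl_flipOn_actCoords, act_flipOn_actCoords,
        bitCompl_bitCompl] at hx ⊢
      revert hx
      simp only [bitCompl]
      cases R (ctrl e s x) <;> cases parity (ctrl e s x) <;> cases act e s x a <;> simp)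
  have h2 := card_act_mem e s (tails L)ᶜ
  have h3 := card_tails hL
  have h4 : ((tails L)ᶜ.card : ℝ) = 2 ^ k - 2 * L.card := by
    rw [Finset.card_compl, h3, Nat.cast_sub]
    · simp
    · rw [← h3]
      exact Finset.card_le_univ _
  rw [dist]
  set N := (Finset.univ.filter fun x : Cube n => hardFun e s a L false R x ≠ R (ctrl e s x)).card
  set M := (Finset.univ.filter fun x : Cube n => act e s x ∈ (tails L)ᶜ).card
  have h1' : 2 * (N : ℝ) ≤ M := mod_cast h1
  have h2' : (M : ℝ) * 2 ^ k = (2 ^ k - 2 * L.card) * 2 ^ n := by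
    rw [← h4]
    exact mod_cast h2
  have h5 : (1 - 2 * (L.card : ℝ) / 2 ^ k) = M / 2 ^ n := by
    field_simp
    linarith
  rw [h5, div_div, mul_comm, ← div_div]
  gcongr
  linarith

/-- `R` changes at a substantial fraction of the edges of the cube in each direction. -/
def Spread (R : Cube k → Bool) : Prop :=
  ∀ i, 4 * (Finset.univ.filter fun u => R (flipOn {i} u) = R u).card ≤ 3 * 2 ^ k

/-- A set `S` of at most `k` coordinates either is the set of control coordinates, in which case the
function is odd under a flip that `g` ignores, or misses a control coordinate, whose flip `g`
ignores. -/
theorem le_distJunta_hardFun_true (hL : ∀ v ∈ L, bitCompl v ∉ L) (hR : Spread R) :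
    (1 - 3 / 4 * (2 * L.card / 2 ^ k)) / 2 ≤ distJunta k (hardFun e s a L true R) := by
  refine le_distJunta fun S g hS hg => ?_
  have h3 := card_tails hL
  by_cases hC : ctrlCoords e s ⊆ S
  · have hcard : (ctrlCoords e s).card = k := by
      rw [ctrlCoords, Finset.card_image_of_injective _ (ctrl_coord_injective e s)]
      simp
    have hCS : ctrlCoords e s = S := Finset.eq_of_subset_of_card_le hC (by omega)
    have hdisj : ∀ j ∈ actCoords e s, j ∉ (S : Set (Fin n)) := by
      rw [← hCS]
      intro j hj hj'
      obtain ⟨i, -, rfl⟩ := Finset.mem_image.1 hj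
      obtain ⟨i', -, hi'⟩ := Finset.mem_image.1 (Finset.mem_coe.1 hj')
      have := e.injective hi'
      simp only [Prod.mk.injEq] at this
      obtain ⟨rfl, h⟩ := this
      simp at h
    have hall : ∀ x, hardFun e s a L true R (flipOn (actCoords e s) x) ≠
        hardFun e s a L true R x := by
      intro x
      simp only [hardFun, ctrl_flipOn_actCoords, act_flipOn_actCoords, bitCompl_bitCompl]
      by_cases h1 : act e s x ∈ L
      · simp [h1, hL _ h1]
      · by_cases h2 : bitCompl (act e s x) ∈ L
        · simp [h1, h2]
        · simp [h1, h2, bitCompl]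
    have := card_filter_div_le_dist (hardFun e s a L true R) g
      (flipOn_involutive (actCoords e s)) (DependsOn.comp_flipOn hg hdisj)
    simp only [ne_eq, hall, not_false_eq_true, Finset.filter_true, Finset.card_univ,
      Fintype.card_fun, Fintype.card_bool, Fintype.card_fin, Nat.cast_pow, Nat.cast_ofNat,
      div_self (pow_ne_zero n (two_ne_zero' ℝ))] at this
    refine le_trans ?_ this
    have : (0 : ℝ) ≤ 2 * L.card / 2 ^ k := by positivity
    linarith
  · obtain ⟨j, hj, hjS⟩ := Finset.not_subset.1 hC
    obtain ⟨i, -, rfl⟩ := Finset.mem_image.1 hj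
    have h := card_filter_div_le_dist (hardFun e s a L true R) g
      (flipOn_involutive {e (i, s i)}) (DependsOn.comp_flipOn hg (by simpa using hjS))
    refine le_trans ?_ h
    set U := Finset.univ.filter fun u => R (flipOn {i} u) = R u with hU
    have hP := card_ctrl_mem_act_mem e s U (tails L)
    set P := Finset.univ.filter fun x : Cube n => ctrl e s x ∈ U ∧ act e s x ∈ tails L with hPdef
    set Q := Finset.univ.filter fun x : Cube n =>
      hardFun e s a L true R (flipOn {e (i, s i)} x) ≠ hardFun e s a L true R x with hQdef
    -- The flip can preserve the value only on the tails, and there only at control vectors in `U`.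
    have hsub : Pᶜ ⊆ Q := by
      intro x hx
      simp only [hPdef, hU, hQdef, tails, Finset.mem_compl, Finset.mem_filter, Finset.mem_univ,
        true_and, hardFun, ctrl_flipOn_singleton, act_flipOn_singleton] at hx ⊢
      by_cases h1 : act e s x ∈ L
      · simp only [h1, true_or, and_true] at hx
        simpa [h1] using hx
      · by_cases h2 : bitCompl (act e s x) ∈ L
        · simp only [h2, or_true, and_true] at hx
          simpa [h1, h2] using hx
        · simp [h1, h2, parity_flipOn_singleton]
    have hcard := Finset.card_le_card hsub
    have hPQ : (2 : ℝ) ^ n ≤ P.card + Q.card := by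
      rw [Finset.card_compl] at hcard
      have : Fintype.card (Cube n) = 2 ^ n := by simp
      have : 2 ^ n ≤ P.card + Q.card := by omega
      exact mod_cast this
    have hP' : (P.card : ℝ) * (2 ^ k * 2 ^ k) = U.card * (2 * L.card) * 2 ^ n := by
      rw [h3] at hP
      exact mod_cast hP
    have hU' : 4 * (U.card : ℝ) ≤ 3 * 2 ^ k := mod_cast hR i
    have hP2 : (P.card : ℝ) / 2 ^ n ≤ 3 / 4 * (2 * L.card / 2 ^ k) := by
      rw [div_le_iff₀ (by positivity)]
      have h2k : (0 : ℝ) < 2 ^ k := by positivity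
      rw [← mul_le_mul_iff_of_pos_right (show (0 : ℝ) < 2 ^ k * 2 ^ k by positivity), hP']
      have : 3 / 4 * (2 * (L.card : ℝ) / 2 ^ k) * 2 ^ n * (2 ^ k * 2 ^ k) =
        (3 / 4 * 2 ^ k) * (2 * L.card) * 2 ^ n := by field_simp
      rw [this]
      gcongr
      linarith
    have : 1 - (P.card : ℝ) / 2 ^ n ≤ Q.card / 2 ^ n := by
      rw [sub_le_iff_le_add, ← add_div, le_div_iff₀ (by positivity)]
      linarith
    linarith

end HardFunctions

/-! ### Most functions are spread: a second moment bound -/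

section Spread

variable {k : ℕ}

/-- `±1`-valued indicator of `R` being constant on the edge in direction `i` at `u`. -/
def edgeSign (i : Fin k) (R : Cube k → Bool) (u : Cube k) : ℤ :=
  if R (flipOn {i} u) = R u then 1 else -1

/-- Negating the single value `R u` reverses the sign at `u` and keeps the one at `v`, since `v` is
on another edge. -/
theorem sum_edgeSign_mul (i : Fin k) {u v : Cube k} (h1 : v ≠ u) (h2 : v ≠ flipOn {i} u) :
    ∑ R : Cube k → Bool, edgeSign i R u * edgeSign i R v = 0 := by
  have hne : flipOn {i} u ≠ u := fun h => by
    have := congrFun h i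
    simp [flipOn] at this
  have hv : flipOn {i} v ≠ u := fun h => h2 (by rw [← h, flipOn_involutive])
  have hinv : Function.Involutive (flipOn {u} : (Cube k → Bool) → Cube k → Bool) :=
    flipOn_involutive {u}
  have hu' : ∀ R : Cube k → Bool, edgeSign i (flipOn {u} R) u = -edgeSign i R u := by
    intro R
    simp only [edgeSign, flipOn, Finset.mem_singleton] at hne ⊢
    simp only [hne, if_false, if_true]
    cases R _ <;> cases R u <;> simp
  have hv' : ∀ R : Cube k → Bool, edgeSign i (flipOn {u} R) v = edgeSign i R v := by
    intro R
    simp only [edgeSign, flipOn, Finset.mem_singleton] at hv ⊢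
    simp only [hv, h1, if_false]
  have := Equiv.sum_comp hinv.toPerm fun R : Cube k → Bool => edgeSign i R u * edgeSign i R v
  simp only [Function.Involutive.coe_toPerm, hu', hv', neg_mul, Finset.sum_neg_distrib] at this
  omega

theorem sum_sq_sum_edgeSign_le (i : Fin k) :
    ∑ R : Cube k → Bool, (∑ u, edgeSign i R u) ^ 2 ≤
      Fintype.card (Cube k → Bool) * (2 * 2 ^ k) := by
  have h1 : ∀ (R : Cube k → Bool) (u v : Cube k), edgeSign i R u * edgeSign i R v ≤ 1 := by
    intro R u v
    unfold edgeSign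
    split_ifs <;> norm_num
  calc ∑ R : Cube k → Bool, (∑ u, edgeSign i R u) ^ 2
      = ∑ u, ∑ v, ∑ R : Cube k → Bool, edgeSign i R u * edgeSign i R v := by
        simp only [sq, Finset.sum_mul_sum]
        rw [Finset.sum_comm]
        exact Finset.sum_congr rfl fun u _ => Finset.sum_comm
    _ ≤ ∑ u : Cube k, 2 * (Fintype.card (Cube k → Bool) : ℤ) := by
        refine Finset.sum_le_sum fun u _ => ?_
        rw [← Finset.sum_subset (Finset.subset_univ {u, flipOn {i} u}) (by
          intro v _ hv
          simp only [Finset.mem_insert, Finset.mem_singleton, not_or] at hv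
          exact sum_edgeSign_mul i hv.1 hv.2)]
        refine (Finset.sum_le_card_nsmul _ _ (Fintype.card (Cube k → Bool) : ℤ) ?_).trans ?_
        · intro v _
          refine (Finset.sum_le_card_nsmul _ _ 1 fun R _ => h1 R u v).trans ?_
          simp
        · rw [nsmul_eq_mul]
          have : (({u, flipOn {i} u} : Finset (Cube k)).card : ℤ) ≤ 2 := mod_cast Finset.card_le_two
          gcongr
    _ = Fintype.card (Cube k → Bool) * (2 * 2 ^ k) := by
        rw [Finset.sum_const, Finset.card_univ, nsmul_eq_mul]
        have : (Fintype.card (Cube k) : ℤ) = 2 ^ k := by simp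
        rw [this]
        ring

theorem sum_edgeSign (i : Fin k) (R : Cube k → Bool) :
    ∑ u, edgeSign i R u =
      2 * (Finset.univ.filter fun u => R (flipOn {i} u) = R u).card - 2 ^ k := by
  have h : ∀ u, edgeSign i R u = 2 * (if R (flipOn {i} u) = R u then 1 else 0) - 1 := by
    intro u
    unfold edgeSign
    split_ifs <;> norm_num
  simp only [h, Finset.sum_sub_distrib, ← Finset.mul_sum]
  simp

/-- Chebyshev's inequality in each direction, then a union bound over the `k` directions. -/
theorem card_not_spread_le :
    2 ^ k * {R : Cube k → Bool | ¬ Spread R}.ncard ≤ 8 * k * Fintype.card (Cube k → Bool) := by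
  classical
  set B : Fin k → Finset (Cube k → Bool) := fun i => Finset.univ.filter fun R =>
    3 * 2 ^ k < 4 * (Finset.univ.filter fun u => R (flipOn {i} u) = R u).card with hB
  have hsub : {R : Cube k → Bool | ¬ Spread R} ⊆ (Finset.univ.biUnion B : Finset _) := by
    intro R hR
    simp only [Spread, Set.mem_ofPred_eq, not_forall, not_le] at hR
    obtain ⟨i, hi⟩ := hR
    simp only [Finset.coe_biUnion, Set.mem_iUnion]
    exact ⟨i, by simp, by simpa [hB] using hi⟩
  have hBi : ∀ i, 2 ^ k * (B i).card ≤ 8 * Fintype.card (Cube k → Bool) := by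
    intro i
    have h := sum_sq_sum_edgeSign_le i
    -- For `R` in `B i` the signs sum to more than `2^k / 2`; squaring accounts for the factor 4.
    have h2 : ((B i).card : ℤ) * (2 ^ k) ^ 2 ≤
        4 * ∑ R : Cube k → Bool, (∑ u, edgeSign i R u) ^ 2 := by
      rw [Finset.mul_sum, ← nsmul_eq_mul]
      refine (Finset.card_nsmul_le_sum _ _ _ ?_).trans
        (Finset.sum_le_univ_sum_of_nonneg fun R => by positivity)
      intro R hR
      simp only [hB, Finset.mem_filter, Finset.mem_univ, true_and] at hR
      rw [sum_edgeSign]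
      zify at hR
      have hpos : (0 : ℤ) < 2 ^ k := by positivity
      nlinarith
    have hpos : (0 : ℤ) < 2 ^ k := by positivity
    have h3 : ((2 : ℤ) ^ k * (B i).card) * 2 ^ k ≤
        (8 * Fintype.card (Cube k → Bool)) * 2 ^ k := by linarith
    have h4 := le_of_mul_le_mul_right h3 hpos
    exact mod_cast h4
  calc 2 ^ k * {R : Cube k → Bool | ¬ Spread R}.ncard
      ≤ 2 ^ k * ∑ i, (B i).card := by
        gcongr
        refine (Set.ncard_le_ncard hsub (Finset.finite_toSet _)).trans ?_
        rw [Set.ncard_coe_finset]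
        exact Finset.card_biUnion_le
    _ = ∑ i, 2 ^ k * (B i).card := by rw [Finset.mul_sum]
    _ ≤ ∑ _i : Fin k, 8 * Fintype.card (Cube k → Bool) := Finset.sum_le_sum fun i _ => hBi i
    _ = 8 * k * Fintype.card (Cube k → Bool) := by
        rw [Finset.sum_const, Finset.card_univ, Fintype.card_fin, smul_eq_mul]
        ring

end Spread

/-! ### Indistinguishability under few queries -/

section Indistinguishability

variable {n k q : ℕ} (e : Fin k × Bool ↪ Fin n)

/-- The selectors under which some pair of queries reaches both tails of one cell. -/
def revealing (L : Finset (Cube k)) (X : Fin q → Cube n) : Finset (Cube k) :=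
  Finset.univ.filter fun s => ∃ j j', ctrl e s (X j) = ctrl e s (X j') ∧ act e s (X j) ∈ L ∧
    bitCompl (act e s (X j')) ∈ L

/-- Negating `R` on the cells with a query in the upper tail undoes `σ` there, and no cell so
treated has a query in the lower tail. The middle does not involve `R`. -/
theorem exists_perm_hardFun {L : Finset (Cube k)} {X : Fin q → Cube n} {s : Cube k}
    (hs : s ∉ revealing e L X) (a : Fin k) :
    ∃ π : Equiv.Perm (Cube k → Bool), ∀ R j,
      hardFun e s a L false R (X j) = hardFun e s a L true (π R) (X j) := by
  classical
  set D : Finset (Cube k) := Finset.univ.filter fun u =>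
    ∃ j, ctrl e s (X j) = u ∧ bitCompl (act e s (X j)) ∈ L with hD
  refine ⟨(flipOn_involutive D).toPerm, fun R j => ?_⟩
  simp only [revealing, Finset.mem_filter, Finset.mem_univ, true_and, not_exists, not_and] at hs
  simp only [hardFun, Function.Involutive.coe_toPerm]
  by_cases h1 : act e s (X j) ∈ L
  · have : ctrl e s (X j) ∉ D := by
      simp only [hD, Finset.mem_filter, Finset.mem_univ, true_and, not_exists, not_and]
      exact fun j' hj' => hs j j' hj'.symm h1
    simp [h1, flipOn, this]
  · by_cases h2 : bitCompl (act e s (X j)) ∈ L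
    · have : ctrl e s (X j) ∈ D := by
        simp only [hD, Finset.mem_filter, Finset.mem_univ, true_and]
        exact ⟨j, rfl, h2⟩
      simp [h1, h2, flipOn, this]
    · simp [h1, h2]

theorem card_filter_eqOn (D : Finset (Fin k)) (s : Cube k) :
    (Finset.univ.filter fun s' : Cube k => ∀ i ∈ D, s' i = s i).card * 2 ^ D.card = 2 ^ k := by
  classical
  have h := card_filter_comp_mem (n := k) (φ := fun i : D => (i : Fin k))
    Subtype.coe_injective {fun i : D => s i}
  rw [Fintype.card_coe, Finset.card_singleton, one_mul] at h
  rw [← h]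
  congr 2
  ext s'
  simp [funext_iff]

/-- Where the action bits of `x` and `y` differ under one revealing selector, any other must make
the same choice, or the control bits would differ. At least `d` bits of the selector are thus
forced. -/
theorem card_revealing_pair_le {L : Finset (Cube k)} {d : ℕ}
    (hL : ∀ u ∈ L, ∀ v ∈ L, d ≤ hammingDist u (bitCompl v)) (x y : Cube n) :
    (Finset.univ.filter fun s => ctrl e s x = ctrl e s y ∧ act e s x ∈ L ∧
      bitCompl (act e s y) ∈ L).card * 2 ^ d ≤ 2 ^ k := by
  set T := Finset.univ.filter fun s => ctrl e s x = ctrl e s y ∧ act e s x ∈ L ∧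
    bitCompl (act e s y) ∈ L with hT
  rcases T.eq_empty_or_nonempty with h0 | ⟨s, hs⟩
  · simp [h0]
  simp only [hT, Finset.mem_filter, Finset.mem_univ, true_and] at hs
  set D := Finset.univ.filter fun i => act e s x i ≠ act e s y i with hD
  have hd : d ≤ D.card := by
    have := hL _ hs.2.1 _ hs.2.2
    rwa [bitCompl_bitCompl] at this
  have hsub : T ⊆ Finset.univ.filter fun s' : Cube k => ∀ i ∈ D, s' i = s i := by
    intro s' hs'
    simp only [hT, hD, Finset.mem_filter, Finset.mem_univ, true_and, act] at hs' ⊢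
    intro i hi
    by_contra hne
    have h1 : s' i = !s i := by
      revert hne
      cases s' i <;> cases s i <;> simp
    have h2 := congrFun hs'.1 i
    simp only [ctrl, h1] at h2
    exact (Finset.mem_filter.1 hi).2 h2
  calc T.card * 2 ^ d ≤ (Finset.univ.filter fun s' : Cube k => ∀ i ∈ D, s' i = s i).card *
        2 ^ D.card := by
        gcongr
        norm_num
    _ = 2 ^ k := card_filter_eqOn D s

theorem card_revealing_le {L : Finset (Cube k)} {d : ℕ}
    (hL : ∀ u ∈ L, ∀ v ∈ L, d ≤ hammingDist u (bitCompl v)) (X : Fin q → Cube n) :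
    (revealing e L X).card * 2 ^ d ≤ q ^ 2 * 2 ^ k := by
  have hsub : revealing e L X ⊆ (Finset.univ : Finset (Fin q × Fin q)).biUnion fun p =>
      Finset.univ.filter fun s => ctrl e s (X p.1) = ctrl e s (X p.2) ∧ act e s (X p.1) ∈ L ∧
        bitCompl (act e s (X p.2)) ∈ L := by
    intro s hs
    simp only [revealing, Finset.mem_filter, Finset.mem_univ, true_and] at hs
    obtain ⟨j, j', h⟩ := hs
    simp only [Finset.mem_biUnion, Finset.mem_univ, true_and, Finset.mem_filter]
    exact ⟨(j, j'), h⟩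
  calc (revealing e L X).card * 2 ^ d
      ≤ (∑ p : Fin q × Fin q, (Finset.univ.filter fun s => ctrl e s (X p.1) = ctrl e s (X p.2) ∧
          act e s (X p.1) ∈ L ∧ bitCompl (act e s (X p.2)) ∈ L).card) * 2 ^ d := by
        gcongr
        exact (Finset.card_le_card hsub).trans Finset.card_biUnion_le
    _ ≤ ∑ _p : Fin q × Fin q, 2 ^ k := by
        rw [Finset.sum_mul]
        exact Finset.sum_le_sum fun p _ => card_revealing_pair_le e hL _ _
    _ = q ^ 2 * 2 ^ k := by
        rw [Finset.sum_const, Finset.card_univ, Fintype.card_prod, Fintype.card_fin, smul_eq_mul,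
          sq]

end Indistinguishability

/-! ### From randomized algorithms to counting -/

section Averaging

variable {n q : ℕ} {Out : Type} [MeasurableSpace Out]

theorem measurable_run (f : Cube n → Bool) :
    Measurable fun A : DetAlg n q Out => A.run f :=
  measurable_from_prod_countable_right fun X => measurable_pi_apply fun i => f (X i)

theorem measurableSet_run_mem (f : Cube n → Bool) {T : Set Out} (hT : MeasurableSet T) :
    MeasurableSet {A : DetAlg n q Out | A.run f ∈ T} :=
  measurable_run f hT

/-- The easy direction of Yao's principle: the counting bound for fixed queries and a fixed set of
accepted answers is integrated over `P`. -/
theorem sum_real_run_mem_le {Ω : Type*} [Fintype Ω] (P : Measure (DetAlg n q Out))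
    [IsProbabilityMeasure P] (f g : Ω → Cube n → Bool) {T : Set Out} (hT : MeasurableSet T)
    {b : ℝ} (h : ∀ (X : Fin q → Cube n) (V : Set (Fin q → Bool)),
      ({ω | (fun j => f ω (X j)) ∈ V}.ncard : ℝ) ≤ {ω | (fun j => g ω (X j)) ∈ V}.ncard + b) :
    ∑ ω, P.real {A | A.run (f ω) ∈ T} ≤ ∑ ω, P.real {A | A.run (g ω) ∈ T} + b := by
  classical
  have hm : ∀ f : Cube n → Bool, MeasurableSet {A : DetAlg n q Out | A.run f ∈ T} :=
    fun f => measurableSet_run_mem f hT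
  have hint : ∀ f : Cube n → Bool, Integrable
      ({A : DetAlg n q Out | A.run f ∈ T}.indicator (1 : DetAlg n q Out → ℝ)) P :=
    fun f => (integrable_const 1).indicator (hm f)
  have hsum : ∀ f : Ω → Cube n → Bool, ∑ ω, P.real {A | A.run (f ω) ∈ T} =
      ∫ A, ∑ ω, {A : DetAlg n q Out | A.run (f ω) ∈ T}.indicator 1 A ∂P := by
    intro f
    rw [integral_finsetSum _ fun ω _ => hint (f ω)]
    exact Finset.sum_congr rfl fun ω _ => (integral_indicator_one (hm (f ω))).symm
  have hcount : ∀ (f : Ω → Cube n → Bool) (A : DetAlg n q Out),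
      ∑ ω, {A : DetAlg n q Out | A.run (f ω) ∈ T}.indicator (1 : DetAlg n q Out → ℝ) A =
        {ω | (fun j => f ω (A.1 j)) ∈ A.2 ⁻¹' T}.ncard := by
    intro f A
    rw [Set.ncard_eq_toFinset_card']
    simp only [Set.indicator_apply, Pi.one_apply, Finset.sum_boole]
    congr 2
    ext ω
    simp only [Finset.mem_filter, Finset.mem_univ, true_and, Set.mem_toFinset]
    rfl
  rw [hsum f, hsum g]
  have hb : b = ∫ _A, b ∂P := by simp
  rw [hb, ← integral_add (integrable_finsetSum _ fun ω _ => hint (g ω)) (integrable_const b)]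
  refine integral_mono (integrable_finsetSum _ fun ω _ => hint (f ω))
    ((integrable_finsetSum _ fun ω _ => hint (g ω)).add (integrable_const b)) fun A => ?_
  simp only [hcount]
  exact h A.1 (A.2 ⁻¹' T)

/-- The outputs in `T` separate the functions at distance at most `r₁` from `k`-juntas from those
at distance at least `r₂`. -/
def Decides (k : ℕ) (r₁ r₂ : ℝ) (P : Measure (DetAlg n q Out)) (T : Set Out) : Prop :=
  ∀ f : Cube n → Bool, (distJunta k f ≤ r₁ → 2 / 3 ≤ P.real {A | A.run f ∈ T}) ∧
    (r₂ ≤ distJunta k f → P.real {A | A.run f ∈ T} ≤ 1 / 3)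

/-- Each `f ω` contributes at least `2/3`, and each `g ω` at most `1/3` unless it is exceptionally
close to juntas; the difference must be covered by `b` and the exceptions. -/
theorem Decides.card_le {Ω : Type*} [Fintype Ω] {P : Measure (DetAlg n q Out)}
    [IsProbabilityMeasure P] {k : ℕ} {r₁ r₂ : ℝ} {T : Set Out} (hP : Decides k r₁ r₂ P T)
    (hT : MeasurableSet T) (f g : Ω → Cube n → Bool) (hf : ∀ ω, distJunta k (f ω) ≤ r₁) {b : ℝ}
    (h : ∀ (X : Fin q → Cube n) (V : Set (Fin q → Bool)),
      ({ω | (fun j => f ω (X j)) ∈ V}.ncard : ℝ) ≤ {ω | (fun j => g ω (X j)) ∈ V}.ncard + b) :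
    (Fintype.card Ω : ℝ) ≤ 3 * (b + {ω | distJunta k (g ω) < r₂}.ncard) := by
  classical
  have h1 := sum_real_run_mem_le P f g hT h
  have h2 : (Fintype.card Ω : ℝ) * (2 / 3) ≤ ∑ ω, P.real {A | A.run (f ω) ∈ T} := by
    rw [← nsmul_eq_mul]
    exact Finset.card_nsmul_le_sum _ _ _ fun ω _ => (hP (f ω)).1 (hf ω)
  have h3 : ∑ ω, P.real {A | A.run (g ω) ∈ T} ≤
      ∑ ω, (1 / 3 + if distJunta k (g ω) < r₂ then 1 else 0) := by
    refine Finset.sum_le_sum fun ω _ => ?_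
    split_ifs with hlt
    · linarith [measureReal_le_one (μ := P) (s := {A | A.run (g ω) ∈ T})]
    · linarith [(hP (g ω)).2 (not_lt.1 hlt)]
  have h4 : ∑ ω, ((1 : ℝ) / 3 + if distJunta k (g ω) < r₂ then 1 else 0) =
      Fintype.card Ω * (1 / 3) + {ω | distJunta k (g ω) < r₂}.ncard := by
    rw [Finset.sum_add_distrib, Finset.sum_const, Finset.card_univ, nsmul_eq_mul,
      Set.ncard_eq_toFinset_card', Finset.sum_boole]
    congr 3
    ext ω
    simp
  linarith

/-- A single answer carries no information: a function and its negation have the same distance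
from juntas. -/
theorem Decides.two_le {P : Measure (DetAlg n q Out)} [IsProbabilityMeasure P] {k : ℕ}
    {r₁ r₂ : ℝ} {T : Set Out} (hP : Decides k r₁ r₂ P T) (hT : MeasurableSet T) (hk : k < n)
    (h1 : 0 ≤ r₁) (h2 : r₂ ≤ 1 / 2) : 2 ≤ q := by
  by_contra! hq
  have hconst : ∀ X : Fin q → Cube n, ∃ p : Bool, ∀ j, parity (X j) = p := by
    intro X
    obtain rfl | rfl : q = 0 ∨ q = 1 := by omega
    · exact ⟨true, fun j => j.elim0⟩
    · exact ⟨parity (X 0), fun j => by rw [Subsingleton.elim j 0]⟩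
  -- With at most one query, the parity has a constant value `p` on the queries, so `b ↦ xor b p`
  -- matches the answers of the parities with those of the constants.
  have := hP.card_le hT (fun (b : Bool) _ => b) (fun b x => xor b (parity x))
    (fun b => (distJunta_const b).trans h1) (b := 0) (by
      intro X V
      obtain ⟨p, hp⟩ := hconst X
      rw [add_zero, Nat.cast_le]
      refine le_of_eq (Set.ncard_congr (fun b _ => xor b p) ?_ ?_ ?_)
      · intro b hb
        simpa [hp] using hb
      · intro b b' _ _ h
        simpa using h
      · intro b hb
        exact ⟨xor b p, by simpa [hp] using hb, by simp⟩)
  have h0 : {b : Bool | distJunta k (fun x : Cube n => xor b (parity x)) < r₂} = ∅ := by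
    ext b
    simpa using h2.trans (distJunta_parity hk b)
  rw [h0] at this
  norm_num at this

theorem fortyEight_mul_le_two_pow {k : ℕ} (hk : 9 ≤ k) : 48 * k ≤ 2 ^ k := by
  induction k, hk using Nat.le_induction with
  | base => norm_num
  | succ j hj ih =>
    rw [pow_succ]
    omega

theorem Decides.two_pow_le {P : Measure (DetAlg n q Out)} [IsProbabilityMeasure P] {k : ℕ}
    {r₁ r₂ : ℝ} {T : Set Out} (hP : Decides k r₁ r₂ P T) (hT : MeasurableSet T) (hk : 9 ≤ k)
    (hn : 2 * k ≤ n) {L : Finset (Cube k)} {d : ℕ} (hd : 0 < d)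
    (hL : ∀ u ∈ L, ∀ v ∈ L, d ≤ hammingDist u (bitCompl v))
    (h1 : (1 - 2 * L.card / 2 ^ k) / 2 ≤ r₁) (h2 : r₂ ≤ (1 - 3 / 4 * (2 * L.card / 2 ^ k)) / 2) :
    (2 : ℝ) ^ d ≤ 6 * q ^ 2 := by
  classical
  obtain ⟨e⟩ : Nonempty (Fin k × Bool ↪ Fin n) :=
    Function.Embedding.nonempty_of_card_le (by simp; omega)
  have hL' : ∀ v ∈ L, bitCompl v ∉ L := by
    intro v hv hv'
    have := hL v hv _ hv'
    rw [bitCompl_bitCompl, hammingDist_self] at this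
    omega
  obtain ⟨N, hN⟩ : ∃ N : ℝ, N = (Fintype.card (Cube k → Bool) : ℕ) := ⟨_, rfl⟩
  have hNpos : 0 < N := by
    rw [hN]
    exact mod_cast Fintype.card_pos
  have hΩ : (Fintype.card (Cube k × (Cube k → Bool)) : ℝ) = 2 ^ k * N := by
    rw [Fintype.card_prod, Nat.cast_mul, hN]
    simp
  have key := hP.card_le hT
    (fun ω : Cube k × (Cube k → Bool) => hardFun e ω.1 ⟨0, by omega⟩ L false ω.2)
    (fun ω => hardFun e ω.1 ⟨0, by omega⟩ L true ω.2)
    (fun ω => (distJunta_hardFun_false_le hL').trans h1) (b := q ^ 2 * 2 ^ k / 2 ^ d * N) (by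
      intro X V
      set a : Fin k := ⟨0, by omega⟩
      set F := {ω : Cube k × (Cube k → Bool) | (fun j => hardFun e ω.1 a L false ω.2 (X j)) ∈ V}
      set G := {ω : Cube k × (Cube k → Bool) | (fun j => hardFun e ω.1 a L true ω.2 (X j)) ∈ V}
      choose! π hπ using fun s (hs : s ∉ revealing e L X) => exists_perm_hardFun e hs a
      -- For other selectors, `(s, R) ↦ (s, π s R)` is injective and preserves the answers;
      -- revealing selectors are counted with every `R`.
      have hle : F.ncard ≤ G.ncard + (revealing e L X).card * Fintype.card (Cube k → Bool) := by
        have hsub : F ⊆ {ω ∈ F | ω.1 ∉ revealing e L X} ∪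
            (revealing e L X ×ˢ (Finset.univ : Finset (Cube k → Bool)) : Finset _) := by
          intro ω hω
          by_cases h : ω.1 ∈ revealing e L X
          · exact Or.inr (by simpa using h)
          · exact Or.inl ⟨hω, h⟩
        refine (Set.ncard_le_ncard hsub (Set.toFinite _)).trans
          ((Set.ncard_union_le _ _).trans (add_le_add ?_ ?_))
        · refine Set.ncard_le_ncard_of_injOn (fun ω => (ω.1, π ω.1 ω.2)) ?_ ?_ (Set.toFinite _)
          · rintro ⟨s, R⟩ ⟨hF, hs⟩
            have : (fun j => hardFun e s a L false R (X j)) =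
                fun j => hardFun e s a L true (π s R) (X j) := funext fun j => hπ s hs R j
            change (fun j => hardFun e s a L true (π s R) (X j)) ∈ V
            rw [← this]
            exact hF
          · rintro ⟨s, R⟩ _ ⟨s', R'⟩ _ h
            simp only [Prod.mk.injEq] at h
            obtain ⟨rfl, h⟩ := h
            rw [(π s).injective h]
        · rw [Set.ncard_coe_finset, Finset.card_product, Finset.card_univ]
      have hrev : ((revealing e L X).card : ℝ) ≤ q ^ 2 * 2 ^ k / 2 ^ d := by
        rw [le_div_iff₀ (by positivity)]
        exact mod_cast card_revealing_le e hL X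
      have hle' : (F.ncard : ℝ) ≤ G.ncard + (revealing e L X).card * N := by
        rw [hN]
        exact mod_cast hle
      refine hle'.trans ?_
      gcongr)
  rw [hΩ] at key
  have hbad : ({ω : Cube k × (Cube k → Bool) |
      distJunta k (hardFun e ω.1 ⟨0, by omega⟩ L true ω.2) < r₂}.ncard : ℝ) ≤ 8 * k * N := by
    have hsub : {ω : Cube k × (Cube k → Bool) |
        distJunta k (hardFun e ω.1 ⟨0, by omega⟩ L true ω.2) < r₂} ⊆
        Set.univ ×ˢ {R : Cube k → Bool | ¬ Spread R} := by
      rintro ⟨s, R⟩ h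
      have hlt : distJunta k (hardFun e s ⟨0, by omega⟩ L true R) < r₂ := h
      exact ⟨trivial, fun hR => not_le.2 hlt (h2.trans (le_distJunta_hardFun_true hL' hR))⟩
    have h := (Set.ncard_le_ncard hsub (Set.toFinite _)).trans (Set.ncard_prod).le
    rw [Set.ncard_univ, Nat.card_eq_fintype_card] at h
    have h' : Fintype.card (Cube k) = 2 ^ k := by simp
    rw [h'] at h
    have := h.trans card_not_spread_le
    rw [hN]
    exact mod_cast this
  -- The functions that are not spread cost `3 * 8 * k * N`, which is thus at most half of `2^k *
  -- N`.
  have hk48 : (48 : ℝ) * k ≤ 2 ^ k := by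
    exact mod_cast fortyEight_mul_le_two_pow hk
  have h6 : (2 : ℝ) ^ k * N ≤ 3 * (q ^ 2 * 2 ^ k / 2 ^ d * N) + 2 ^ k * N / 2 := by nlinarith
  have h7 : q ^ 2 * 2 ^ k / 2 ^ d * N = (q ^ 2 / 2 ^ d) * ((2 : ℝ) ^ k * N) := by ring
  rw [h7] at h6
  have h8 : (0 : ℝ) < 2 ^ k * N := by positivity
  have h9 : (1 : ℝ) / 6 ≤ q ^ 2 / 2 ^ d := by
    by_contra! hlt
    nlinarith
  rw [le_div_iff₀ (by positivity)] at h9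
  linarith

theorem IsTolerantTester.decides {k : ℕ} {ε₁ ε₂ : ℝ} {P : Measure (DetAlg n q Bool)}
    [IsProbabilityMeasure P] (hP : IsTolerantTester k ε₁ ε₂ P) :
    Decides k ε₁ ε₂ P {true} := by
  refine fun f => ⟨(hP f).1, fun h => ?_⟩
  have h1 := (hP f).2 h
  have h2 : {A : DetAlg n q Bool | A.run f = false} = {A | A.run f ∈ ({true} : Set Bool)}ᶜ := by
    ext A
    simp
  rw [h2, probReal_compl_eq_one_sub (measurableSet_run_mem f (MeasurableSet.singleton true))] at h1
  linarith

/-- The estimate is compared with `r₁ + ε`, which is less than `r₂ - ε`. -/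
theorem IsDistanceEstimator.decides {k : ℕ} {ε r₁ r₂ : ℝ} {P : Measure (DetAlg n q ℝ)}
    [IsProbabilityMeasure P] (hP : IsDistanceEstimator k ε P) (hr : 2 * ε < r₂ - r₁) :
    Decides k r₁ r₂ P (Set.Iic (r₁ + ε)) := by
  refine fun f => ⟨fun h => (hP f).trans ?_, fun h => ?_⟩
  · refine measureReal_mono fun A hA => ?_
    have := (abs_le.1 (show |A.run f - distJunta k f| ≤ ε from hA)).2
    change A.run f ≤ r₁ + ε
    linarith
  · have h1 := hP f
    have h2 : {A : DetAlg n q ℝ | |A.run f - distJunta k f| ≤ ε} ⊆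
        {A | A.run f ∈ Set.Iic (r₁ + ε)}ᶜ := by
      intro A hA hA'
      have := (abs_le.1 (show |A.run f - distJunta k f| ≤ ε from hA)).1
      have h3 : A.run f ≤ r₁ + ε := hA'
      linarith
    have h3 := h1.trans (measureReal_mono h2)
    rw [probReal_compl_eq_one_sub (measurableSet_run_mem f measurableSet_Iic)] at h3
    linarith

end Averaging

/-! ### Dense sets far from their complements -/

section Separation

theorem centralBinom_sq_mul_le (n : ℕ) : n.centralBinom ^ 2 * (2 * n + 1) ≤ 16 ^ n := by
  induction n with
  | zero => simp
  | succ n ih =>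
    have h := Nat.succ_mul_centralBinom_succ n
    have h2 : (n + 1) ^ 2 * ((n + 1).centralBinom ^ 2 * (2 * (n + 1) + 1)) ≤
        (n + 1) ^ 2 * 16 ^ (n + 1) := by
      calc (n + 1) ^ 2 * ((n + 1).centralBinom ^ 2 * (2 * (n + 1) + 1))
          = ((n + 1) * (n + 1).centralBinom) ^ 2 * (2 * n + 3) := by ring
        _ = (n.centralBinom ^ 2 * (2 * n + 1)) * (4 * ((2 * n + 1) * (2 * n + 3))) := by
            rw [h]
            ring
        _ ≤ 16 ^ n * (4 * (4 * (n + 1) ^ 2)) := by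
            have h3 : (2 * n + 1) * (2 * n + 3) ≤ 4 * (n + 1) ^ 2 := by nlinarith
            exact Nat.mul_le_mul ih (Nat.mul_le_mul_left 4 h3)
        _ = (n + 1) ^ 2 * 16 ^ (n + 1) := by ring
    exact Nat.le_of_mul_le_mul_left h2 (by positivity)

variable {k : ℕ}

/-- The Hamming weight. -/
def weight (u : Cube k) : ℕ := (Finset.univ.filter fun i => u i = true).card

theorem weight_bitCompl_add (u : Cube k) : weight (bitCompl u) + weight u = k := by
  have := Finset.card_filter_add_card_filter_not (s := (Finset.univ : Finset (Fin k)))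
    (fun i => u i = true)
  simp only [Finset.card_univ, Fintype.card_fin] at this
  have h2 : weight (bitCompl u) = (Finset.univ.filter fun i => ¬ u i = true).card := by
    simp [weight, bitCompl]
  rw [h2, add_comm]
  exact this

theorem card_weight_eq_le (j : ℕ) :
    (Finset.univ.filter fun u : Cube k => weight u = j).card ≤ k.choose j := by
  have h : (Finset.powersetCard j (Finset.univ : Finset (Fin k))).card = k.choose j := by
    simp
  rw [← h]
  refine Finset.card_le_card_of_injOn (fun u => Finset.univ.filter fun i => u i = true) ?_ ?_
  · intro u hu
    exact Finset.mem_coe.2 (Finset.mem_powersetCard.2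
      ⟨Finset.subset_univ _, (Finset.mem_filter.1 (Finset.mem_coe.1 hu)).2⟩)
  · intro u _ v _ huv
    ext i
    have := Finset.ext_iff.1 huv i
    simpa using this

/-- A coordinate where `u` and `v` both vanish is one where `u` differs from the complement of `v`.
-/
theorem le_hammingDist_bitCompl (u v : Cube k) :
    k ≤ hammingDist u (bitCompl v) + weight u + weight v := by
  have hsub : (Finset.univ : Finset (Fin k)) ⊆
      ((Finset.univ.filter fun i => u i ≠ bitCompl v i) ∪
        Finset.univ.filter fun i => u i = true) ∪ Finset.univ.filter fun i => v i = true := by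
    intro i _
    simp only [Finset.mem_union, Finset.mem_filter, Finset.mem_univ, true_and, bitCompl]
    cases hu : u i <;> cases hv : v i <;> simp [hu, hv]
  have := Finset.card_le_card hsub
  rw [Finset.card_univ, Fintype.card_fin] at this
  refine this.trans ((Finset.card_union_le _ _).trans ?_)
  gcongr
  · exact Finset.card_union_le _ _
  · exact le_rfl

/-- The cube has a subset of density at least `p` at distance at least `d` from its complement
image. -/
def HasSeparation (k : ℕ) (p : ℝ) (d : ℕ) : Prop :=
  ∃ L : Finset (Cube k), p * 2 ^ k ≤ L.card ∧ ∀ u ∈ L, ∀ v ∈ L, d ≤ hammingDist u (bitCompl v)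

theorem hasSeparation_one_zero (k : ℕ) : HasSeparation k 1 0 :=
  ⟨Finset.univ, by simp, by simp⟩

/-- For products of sets, densities multiply and distances add. -/
theorem HasSeparation.add {k k' : ℕ} {p p' : ℝ} {d d' : ℕ} (hp' : 0 ≤ p')
    (h : HasSeparation k p d) (h' : HasSeparation k' p' d') :
    HasSeparation (k + k') (p * p') (d + d') := by
  obtain ⟨L, h1, h2⟩ := h
  obtain ⟨L', h1', h2'⟩ := h'
  refine ⟨(L ×ˢ L').map (Fin.appendEquiv k k').toEmbedding, ?_, ?_⟩
  · rw [Finset.card_map, Finset.card_product, Nat.cast_mul, pow_add]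
    calc p * p' * (2 ^ k * 2 ^ k') = (p * 2 ^ k) * (p' * 2 ^ k') := by ring
      _ ≤ L.card * (p' * 2 ^ k') := by
          gcongr
      _ ≤ L.card * L'.card := by gcongr
  · intro u hu v hv
    obtain ⟨⟨u1, u2⟩, hu', rfl⟩ := Finset.mem_map.1 hu
    obtain ⟨⟨v1, v2⟩, hv', rfl⟩ := Finset.mem_map.1 hv
    rw [Finset.mem_product] at hu' hv'
    have ha := h2 u1 hu'.1 v1 hv'.1
    have hb := h2' u2 hu'.2 v2 hv'.2
    refine (add_le_add ha hb).trans (le_of_eq ?_)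
    simp only [hammingDist, Finset.card_filter, Fin.sum_univ_add]
    simp [Fin.appendEquiv, bitCompl]

/-- Take the vectors of weight at most `n - t` in dimension `2n`, where `n = 50t²`. The `2t - 1`
middle layers fill at most a fifth of the cube, as the central binomial coefficient is at most `4^n
/ (10t)`, and by symmetry the lower tail has at least half of the rest. -/
theorem hasSeparation_block {t : ℕ} (ht : 1 ≤ t) :
    HasSeparation (100 * t ^ 2) (2 / 5) (2 * t) := by
  have ht2 : t ≤ t ^ 2 := Nat.le_self_pow two_ne_zero t
  obtain ⟨n, hn⟩ : ∃ n, n = 50 * t ^ 2 := ⟨_, rfl⟩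
  have hk : 100 * t ^ 2 = 2 * n := by omega
  rw [hk]
  set L := Finset.univ.filter fun u : Cube (2 * n) => weight u ≤ n - t with hL
  refine ⟨L, ?_, ?_⟩
  · set U := Finset.univ.filter fun u : Cube (2 * n) => n + t ≤ weight u with hU
    set M := (Finset.Ioo (n - t) (n + t)).biUnion fun j =>
      Finset.univ.filter fun u : Cube (2 * n) => weight u = j with hM
    have hUL : U.card ≤ L.card := by
      refine Finset.card_le_card_of_injOn bitCompl ?_
        (Function.Involutive.injective bitCompl_bitCompl).injOn
      intro u hu
      simp only [hU, hL, Finset.coe_filter, Finset.mem_univ, true_and, Set.mem_ofPred_eq] at hu ⊢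
      have := weight_bitCompl_add u
      omega
    have hcover : (Finset.univ : Finset (Cube (2 * n))) ⊆ (L ∪ U) ∪ M := by
      intro u _
      simp only [hL, hU, hM, Finset.mem_union, Finset.mem_filter, Finset.mem_univ, true_and,
        Finset.mem_biUnion, Finset.mem_Ioo, exists_eq_right']
      omega
    have hMcard : M.card ≤ (2 * t - 1) * n.centralBinom := by
      refine Finset.card_biUnion_le.trans ?_
      refine (Finset.sum_le_card_nsmul _ _ n.centralBinom fun j _ =>
        (card_weight_eq_le j).trans (Nat.choose_le_centralBinom j n)).trans ?_
      rw [smul_eq_mul, Nat.card_Ioo]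
      gcongr
      omega
    have hcentral : 10 * t * n.centralBinom ≤ 4 ^ n := by
      have h := centralBinom_sq_mul_le n
      rw [← Nat.pow_le_pow_iff_left two_ne_zero]
      calc (10 * t * n.centralBinom) ^ 2 = n.centralBinom ^ 2 * (2 * n) := by
            rw [hn]
            ring
        _ ≤ n.centralBinom ^ 2 * (2 * n + 1) := by gcongr; omega
        _ ≤ 16 ^ n := h
        _ = (4 ^ n) ^ 2 := by rw [pow_right_comm]; norm_num
    have hcard := Finset.card_le_card hcover
    have hcard2 := (hcard.trans (Finset.card_union_le _ _)).trans
      (add_le_add (Finset.card_union_le _ _) hMcard)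
    have h2n : Fintype.card (Cube (2 * n)) = 4 ^ n := by
      simp [pow_mul]
    rw [Finset.card_univ, h2n] at hcard2
    have hM5 : 5 * ((2 * t - 1) * n.centralBinom) ≤ 4 ^ n := by
      refine le_trans ?_ hcentral
      calc 5 * ((2 * t - 1) * n.centralBinom) = 5 * (2 * t - 1) * n.centralBinom := by ring
        _ ≤ 10 * t * n.centralBinom := Nat.mul_le_mul_right _ (by omega)
    have hfin : 2 * 4 ^ n ≤ 5 * L.card := by omega
    have hfin' : (2 : ℝ) * 4 ^ n ≤ 5 * L.card := mod_cast hfin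
    rw [pow_mul]
    norm_num
    linarith
  · intro u hu v hv
    have := le_hammingDist_bitCompl u v
    simp only [hL, Finset.mem_filter, Finset.mem_univ, true_and] at hu hv
    omega

theorem hasSeparation_blocks {t : ℕ} (ht : 1 ≤ t) (m : ℕ) :
    HasSeparation (100 * t ^ 2 * m) ((2 / 5) ^ m) (2 * t * m) := by
  induction m with
  | zero => simpa using hasSeparation_one_zero 0
  | succ m ih =>
    rw [pow_succ]
    exact ih.add (by positivity) (hasSeparation_block ht)

theorem hasSeparation_of_le {t m : ℕ} (ht : 1 ≤ t) (hk : 100 * t ^ 2 * m ≤ k) :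
    HasSeparation k ((2 / 5) ^ m) (2 * t * m) := by
  obtain ⟨r, rfl⟩ := Nat.exists_eq_add_of_le hk
  simpa using (hasSeparation_blocks ht m).add (by positivity) (hasSeparation_one_zero r)

end Separation

/-! ### Choice of parameters -/

section Thresholds

theorem eight_mul_lt_two_fifths_pow {ε : ℝ} (h0 : 0 < ε) (h1 : ε < 1 / 20) :
    8 * ε < (2 / 5 : ℝ) ^ ⌈Real.log (1 / ε) / 10⌉₊ := by
  set m := ⌈Real.log (1 / ε) / 10⌉₊ with hm
  have hlog : 0 < Real.log (1 / ε) := Real.log_pos (by rw [lt_div_iff₀ h0]; linarith)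
  have hm1 : 1 ≤ m := Nat.one_le_ceil_iff.2 (by positivity)
  rcases hm1.eq_or_lt with h | h
  · rw [← h]
    linarith
  have hm2 : (2 : ℝ) ≤ m := mod_cast h
  have hlt : (m : ℝ) < Real.log (1 / ε) / 10 + 1 := Nat.ceil_lt_add_one (by positivity)
  have h5 : (5 : ℝ) * m < Real.log (1 / ε) := by linarith
  have hexp : Real.exp (5 * m) < 1 / ε := by
    -- For `m ≥ 2`, rounding up at most doubles `log (1 / ε) / 10`, whence `5m < log (1 / ε)`.
    rwa [← Real.lt_log_iff_exp_lt (by positivity)]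
  have h32 : (20 : ℝ) ≤ Real.exp 5 := by
    have h2 : (2 : ℝ) ≤ Real.exp 1 := by linarith [Real.add_one_le_exp (1 : ℝ)]
    calc (20 : ℝ) ≤ 2 ^ 5 := by norm_num
      _ ≤ Real.exp 1 ^ 5 := by gcongr
      _ = Real.exp 5 := by rw [← Real.exp_nat_mul]; norm_num
  have h20 : (20 : ℝ) ^ m < 1 / ε := by
    refine lt_of_le_of_lt ?_ hexp
    rw [mul_comm, Real.exp_nat_mul]
    gcongr
  rw [lt_div_iff₀ h0] at h20
  have h8 : (8 : ℝ) ≤ 8 ^ m := le_self_pow₀ (by norm_num) (by omega)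
  have hprod : (2 / 5 : ℝ) ^ m * 20 ^ m = 8 ^ m := by
    rw [← mul_pow]
    norm_num
  have hpos : (0 : ℝ) < (2 / 5 : ℝ) ^ m := by positivity
  nlinarith [mul_lt_mul_of_pos_left h20 hpos]

theorem exists_scale {k M : ℕ} (hM : 1 ≤ M) (hk : 100 * M ≤ k) :
    ∃ t, 1 ≤ t ∧ 100 * t ^ 2 * M ≤ k ∧ k ≤ 400 * t ^ 2 * M := by
  have hpos : 0 < 100 * M := by omega
  refine ⟨Nat.sqrt (k / (100 * M)), ?_, ?_, ?_⟩
  · rw [Nat.le_sqrt, Nat.le_div_iff_mul_le hpos]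
    omega
  · have := (Nat.le_div_iff_mul_le hpos).1 (Nat.sqrt_le' (k / (100 * M)))
    linarith
  · have h1 : 1 ≤ Nat.sqrt (k / (100 * M)) := by
      rw [Nat.le_sqrt, Nat.le_div_iff_mul_le hpos]
      omega
    have h2 := (Nat.div_lt_iff_lt_mul hpos).1 (Nat.lt_succ_sqrt' (k / (100 * M)))
    set t := Nat.sqrt (k / (100 * M))
    have h3 : Nat.succ t ^ 2 ≤ 4 * t ^ 2 := by
      rw [Nat.succ_eq_add_one]
      nlinarith
    calc k ≤ Nat.succ t ^ 2 * (100 * M) := h2.le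
      _ ≤ 4 * t ^ 2 * (100 * M) := by gcongr
      _ = 400 * t ^ 2 * M := by ring

/-- Since `q ≥ 2`, the factor 6 is at most `q^3`. -/
theorem two_rpow_le_of_two_pow_le {d q : ℕ} (hq : 2 ≤ q) (h : (2 : ℝ) ^ d ≤ 6 * q ^ 2) :
    (2 : ℝ) ^ ((d : ℝ) / 5) ≤ q := by
  have hq' : (2 : ℝ) ≤ q := mod_cast hq
  have h5 : (2 : ℝ) ^ d ≤ (q : ℝ) ^ 5 := by
    have h3 : (2 : ℝ) ^ 3 ≤ (q : ℝ) ^ 3 := by gcongr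
    nlinarith [sq_nonneg (q : ℝ)]
  rw [← pow_le_pow_iff_left₀ (by positivity) (by positivity) (by norm_num : 5 ≠ 0),
    ← Real.rpow_natCast, ← Real.rpow_mul (by norm_num)]
  norm_num
  exact h5

theorem exists_thresholds_of_large {k : ℕ} (hk : 100 ≤ k) {ε D : ℝ} (h0 : 0 < ε)
    (h1 : ε < 1 / 20) (hD : 1 ≤ D) (hkD : Real.log (1 / ε) ≤ D * k) :
    ∃ r₁ r₂ : ℝ, 0 ≤ r₁ ∧ r₂ ≤ 1 / 2 ∧ 2 * ε < r₂ - r₁ ∧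
      ∀ (n q : ℕ) (Out : Type) [MeasurableSpace Out] (P : Measure (DetAlg n q Out))
        [IsProbabilityMeasure P] (T : Set Out), 2 * k ≤ n → MeasurableSet T →
        Decides k r₁ r₂ P T →
        (2 : ℝ) ^ (Real.sqrt (k * (Real.log (1 / ε) / (200 * D))) / 50) ≤ q := by
  set l := Real.log (1 / ε) with hl
  set m := ⌈l / 10⌉₊ with hm
  have hlpos : 0 < l := Real.log_pos (by rw [lt_div_iff₀ h0]; linarith)
  have hm1 : 1 ≤ m := Nat.one_le_ceil_iff.2 (by positivity)
  -- The cap `k / 100` leaves room for `M` blocks with `t ≥ 1`. As `log (1 / ε) ≤ D * k`, it costs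
  -- only a factor depending on `D`.
  set M := min m (k / 100) with hM
  have hM1 : 1 ≤ M := le_min hm1 (by omega)
  have hMk : 100 * M ≤ k := by
    have : M ≤ k / 100 := min_le_right _ _
    omega
  have hMl : l / (200 * D) ≤ M := by
    rw [hM, Nat.cast_min]
    refine le_min ?_ ?_
    · refine le_trans ?_ (Nat.le_ceil (l / 10))
      gcongr
      linarith
    · have h2 : k ≤ 200 * (k / 100) := by omega
      have h2' : (k : ℝ) ≤ 200 * (k / 100 : ℕ) := mod_cast h2
      rw [div_le_iff₀ (by positivity)]
      calc l ≤ D * k := hkD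
        _ ≤ D * (200 * (k / 100 : ℕ)) := by gcongr
        _ = (k / 100 : ℕ) * (200 * D) := by ring
  obtain ⟨t, ht, htk, hkt⟩ := exists_scale hM1 hMk
  obtain ⟨L, hLcard, hL⟩ := hasSeparation_of_le ht htk
  have hd : 0 < 2 * t * M := by positivity
  have hL' : ∀ v ∈ L, bitCompl v ∉ L := by
    intro v hv hv'
    have := hL v hv _ hv'
    rw [bitCompl_bitCompl, hammingDist_self] at this
    omega
  have hτ1 : 2 * (L.card : ℝ) / 2 ^ k ≤ 1 := by
    rw [div_le_one (by positivity)]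
    have h := Finset.card_le_univ (tails L)
    rw [card_tails hL'] at h
    have h2 : Fintype.card (Cube k) = 2 ^ k := by simp
    rw [h2] at h
    exact mod_cast h
  have hτ0 : 16 * ε < 2 * (L.card : ℝ) / 2 ^ k := by
    rw [lt_div_iff₀ (by positivity)]
    have h2 : (2 / 5 : ℝ) ^ m ≤ (2 / 5) ^ M :=
      pow_le_pow_of_le_one (by norm_num) (by norm_num) (min_le_left _ _)
    have h3 : 8 * ε < (2 / 5 : ℝ) ^ M := (eight_mul_lt_two_fifths_pow h0 h1).trans_le h2
    have h4 : (8 * ε) * 2 ^ k < (2 / 5 : ℝ) ^ M * 2 ^ k := by gcongr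
    linarith
  refine ⟨(1 - 2 * L.card / 2 ^ k) / 2, (1 - 3 / 4 * (2 * L.card / 2 ^ k)) / 2, by linarith,
    by linarith, by linarith, ?_⟩
  intro n q Out _ P _ T hn hT hP
  have hq : 2 ≤ q := hP.two_le hT (by omega) (by linarith) (by linarith)
  have hpow := hP.two_pow_le hT (by omega) hn hd hL le_rfl le_rfl
  refine le_trans ?_ (two_rpow_le_of_two_pow_le hq hpow)
  refine Real.rpow_le_rpow_of_exponent_le (by norm_num) ?_
  -- The separation is `d = 2tM`, so `d / 5 = 20tM / 50`.
  have hsqrt : Real.sqrt (k * (l / (200 * D))) ≤ 20 * (t * M) := by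
    refine Real.sqrt_le_iff.2 ⟨by positivity, ?_⟩
    have hkt' : (k : ℝ) ≤ 400 * t ^ 2 * M := mod_cast hkt
    calc (k : ℝ) * (l / (200 * D)) ≤ (400 * t ^ 2 * M) * M := by gcongr
      _ = (20 * (t * M)) ^ 2 := by ring
  push_cast
  linarith

theorem exists_thresholds {k : ℕ} (hk : 2 ≤ k) {ε D : ℝ} (h0 : 0 < ε)
    (h1 : ε < 1 / 20 ∨ k < 100 ∧ ε < 1 / 4) (hD : 1 ≤ D) (hkD : Real.log (1 / ε) ≤ D * k) :
    ∃ r₁ r₂ : ℝ, 0 ≤ r₁ ∧ r₂ ≤ 1 / 2 ∧ 2 * ε < r₂ - r₁ ∧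
      ∀ (n q : ℕ) (Out : Type) [MeasurableSpace Out] (P : Measure (DetAlg n q Out))
        [IsProbabilityMeasure P] (T : Set Out), 2 * k ≤ n → MeasurableSet T →
        Decides k r₁ r₂ P T →
        Real.exp (1 / (1000 * Real.sqrt (200 * D)) * Real.sqrt (k * Real.log (1 / ε))) ≤ q := by
  have hlog2 := Real.log_two_gt_d9
  have hDpos : 0 < Real.sqrt (200 * D) := Real.sqrt_pos.2 (by positivity)
  rcases lt_or_ge k 100 with hk100 | hk100
  -- For bounded `k` the exponent is at most `1/10`, so `q ≥ 2`, from constants against parities, is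
  -- enough.
  · refine ⟨0, 1 / 2, le_rfl, le_rfl, ?_, ?_⟩
    · rcases h1 with h1 | h1 <;> linarith
    intro n q Out _ P _ T hn hT hP
    have hq : (2 : ℝ) ≤ q := mod_cast hP.two_le hT (by omega) le_rfl le_rfl
    refine le_trans ?_ hq
    rw [← Real.le_log_iff_exp_le (by norm_num)]
    have hk' : (k : ℝ) ≤ 100 := mod_cast hk100.le
    have h2 : Real.sqrt (k * Real.log (1 / ε)) ≤ 100 * Real.sqrt (200 * D) := by
      refine Real.sqrt_le_iff.2 ⟨by positivity, ?_⟩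
      rw [mul_pow, Real.sq_sqrt (by positivity)]
      calc (k : ℝ) * Real.log (1 / ε) ≤ k * (D * k) := by gcongr
        _ ≤ 100 * (D * 100) := by gcongr
        _ ≤ 100 ^ 2 * (200 * D) := by linarith
    calc 1 / (1000 * Real.sqrt (200 * D)) * Real.sqrt (k * Real.log (1 / ε))
        ≤ 1 / (1000 * Real.sqrt (200 * D)) * (100 * Real.sqrt (200 * D)) := by gcongr
      _ = 1 / 10 := by field_simp; norm_num
      _ ≤ Real.log 2 := by linarith
  · obtain ⟨r₁, r₂, hr1, hr2, hr, h⟩ := exists_thresholds_of_large hk100 h0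
      (h1.resolve_right fun h => absurd h.1 (by omega)) hD hkD
    refine ⟨r₁, r₂, hr1, hr2, hr, fun n q Out _ P _ T hn hT hP => ?_⟩
    refine le_trans ?_ (h n q Out P T hn hT hP)
    rw [Real.rpow_def_of_pos (by norm_num), Real.exp_le_exp, ← mul_div_assoc (k : ℝ),
      Real.sqrt_div' _ (by positivity)]
    set y := Real.sqrt (k * Real.log (1 / ε))
    have hy : 0 ≤ y / Real.sqrt (200 * D) := by positivity
    have : 1 / (1000 * Real.sqrt (200 * D)) * y = y / Real.sqrt (200 * D) * (1 / 1000) := by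
      field_simp
    rw [this]
    nlinarith

theorem log_one_div_le {C ε : ℝ} {k : ℕ} (hC : 0 < C) (h : (2 : ℝ) ^ (-(C * (k : ℝ))) ≤ ε) :
    Real.log (1 / ε) ≤ (C + 1) * k := by
  have h0 : (0 : ℝ) < 2 ^ (-(C * (k : ℝ))) := by positivity
  have h1 := Real.log_le_log h0 h
  rw [Real.log_rpow (by norm_num)] at h1
  rw [one_div, Real.log_inv]
  have h2 : Real.log 2 ≤ 1 := by linarith [Real.log_two_lt_d9]
  have h3 : 0 ≤ C * (k : ℝ) := by positivity
  have h4 : (0 : ℝ) ≤ k := by positivity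
  nlinarith

end Thresholds

end JuntaTesting

/-! ### The lower bounds for testers and estimators -/

theorem mainTheorem2 :
    (∀ C : ℝ, 0 < C → ∃ c : ℝ, 0 < c ∧
      ∀ (k : ℕ), 2 ≤ k → ∀ ε : ℝ, (2 : ℝ) ^ (-(C * (k : ℝ))) < ε → ε < 1 / (k : ℝ) ^ 2 →
        ∃ ε₁ ε₂ : ℝ, 0 ≤ ε₁ ∧ ε₁ < ε₂ ∧ ε₂ < 1 / 2 ∧ ε₂ - ε₁ = ε ∧
          ∀ (q : ℕ) (P : MeasureTheory.Measure (JuntaTesting.DetAlg (2 * k) q Bool)),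
            MeasureTheory.IsProbabilityMeasure P →
            JuntaTesting.IsTolerantTester k ε₁ ε₂ P →
            Real.exp (c * Real.sqrt ((k : ℝ) * Real.log (1 / ((k : ℝ) * ε)))) ≤ (q : ℝ)) ∧
    (∃ a : ℕ, ∀ C : ℝ, 0 < C → ∃ c : ℝ, 0 < c ∧
      ∀ (k : ℕ), 2 ≤ k → ∀ n : ℕ, 2 * k ≤ n →
        ∀ ε : ℝ, (2 : ℝ) ^ (-(C * (k : ℝ))) ≤ ε → ε < 1 / 20 →
          ∀ (q : ℕ) (P : MeasureTheory.Measure (JuntaTesting.DetAlg n q ℝ)),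
            MeasureTheory.IsProbabilityMeasure P →
            JuntaTesting.IsDistanceEstimator k ε P →
            (2 : ℝ) ^ (c * Real.sqrt ((k : ℝ) * Real.log (1 / ε)) /
              (Real.log (k : ℝ) * Real.log (Real.log (1 / ε))) ^ a) ≤ (q : ℝ)) := by
  -- The construction loses no logarithmic factor, so `a = 0` serves in the second part.
  refine ⟨fun C hC => ⟨1 / (1000 * Real.sqrt (200 * (C + 1))), by positivity, ?_⟩,
    0, fun C hC => ⟨1 / (1000 * Real.sqrt (200 * (C + 1))), by positivity, ?_⟩⟩
  · intro k hk ε hε hεk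
    have h0 : 0 < ε := lt_trans (by positivity) hε
    have hk2 : (2 : ℝ) ≤ k := mod_cast hk
    have hcase : ε < 1 / 20 ∨ k < 100 ∧ ε < 1 / 4 := by
      rcases lt_or_ge k 100 with hk100 | hk100
      · refine Or.inr ⟨hk100, hεk.trans_le ?_⟩
        rw [div_le_div_iff₀ (by positivity) (by norm_num)]
        nlinarith
      · refine Or.inl (hεk.trans_le ?_)
        have : (100 : ℝ) ≤ k := mod_cast hk100
        rw [div_le_div_iff₀ (by positivity) (by norm_num)]
        nlinarith
    obtain ⟨r₁, r₂, hr1, hr2, hr, h⟩ := JuntaTesting.exists_thresholds hk h0 hcase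
      (by linarith) (JuntaTesting.log_one_div_le hC hε.le)
    -- Since `r₁ + ε < r₂ ≤ 1/2`, a tester with the exact gap `ε` also decides the wider gap.
    refine ⟨r₁, r₁ + ε, hr1, by linarith, by linarith, by ring, fun q P _ hP => ?_⟩
    refine le_trans ?_ (h (2 * k) q Bool P {true} le_rfl (MeasurableSet.singleton true)
      fun f => ⟨(hP.decides f).1, fun hf => (hP.decides f).2 (by linarith)⟩)
    -- Here `ε ≤ k * ε`, so the logarithm of `1 / (k * ε)` is at most that of `1 / ε`.
    gcongr
    nlinarith
  · intro k hk n hn ε hε hε20 q P _ hP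
    have h0 : 0 < ε := lt_of_lt_of_le (by positivity) hε
    obtain ⟨r₁, r₂, hr1, hr2, hr, h⟩ := JuntaTesting.exists_thresholds hk h0 (Or.inl hε20)
      (by linarith) (JuntaTesting.log_one_div_le hC hε)
    refine le_trans ?_ (h n q ℝ P _ hn measurableSet_Iic (hP.decides hr))
    rw [pow_zero, div_one, Real.rpow_def_of_pos (by norm_num), Real.exp_le_exp]
    refine mul_le_of_le_one_left (by positivity) ?_
    linarith [Real.log_two_lt_d9]
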